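/- Let $\mathfrak{A}$ be a (not necessarily unital) C*-algebra which is residually finite-dimensional (RFD), that is, which admits a separating set of $*$-representations on finite-dimensional Hilbert spaces. Let $\pi:\mathfrak{A}\to B(H_\pi)$ be an irreducible $*$-representation, i.e. a nonzero $*$-representation on a complex Hilbert space whose only closed invariant subspaces are $\{0\}$ and $H_\pi$. Call two irreducible $*$-representations $\sigma$ and $\pi$ of $\mathfrak{A}$ weakly equivalent, written $\sigma\sim\pi$, if $\ker\sigma=\ker\pi$. For $n\in\mathbb{N}$ and $T=(T_{ij})\in\mathbb{M}_n(\mathfrak{A})$, let $\pi^{(n)}(T)=(\pi(T_{ij}))_{i,j}\in B(H_\pi^{(n)})$, where $H_\pi^{(n)}$ is the Hilbert space direct sum of $n$ copies of $H_\pi$, and equip it with the operator norm. Assume that there are $n\in\mathbb{N}$ and $T\in\mathbb{M}_n(\mathfrak{A})$ such that \[ \|\pi^{(n)}(T)\|>\sup\bigl\{\|\sigma^{(n)}(T)\| : \sigma \text{ an irreducible } *\text{-representation of } \mathfrak{A},\ \sigma\not\sim\pi\bigr\}, \] where the supremum is taken in $[-\infty,\infty]$ (so it is $-\infty$ if there is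 no such $\sigma$). Then $\pi$ is finite-dimensional, i.e. $\dim H_\pi<\infty$. -/

import Mathlib

universe u v w

/-- A `*`-representation of a (not necessarily unital) C*-algebra `A`: a `*`-homomorphism from `A`
into the bounded operators on some complex Hilbert space. -/
structure StarRep (A : Type u) [NonUnitalCStarAlgebra A] where
  /-- the Hilbert space of the representation -/
  space : Type v
  [normedAddCommGroup : NormedAddCommGroup space]
  [innerProductSpace : InnerProductSpace ℂ space]
  [completeSpace : CompleteSpace space]
  /-- the underlying `*`-homomorphism -/
  hom : A →⋆ₙₐ[ℂ] (space →L[ℂ] space)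

namespace StarRep

attribute [instance] normedAddCommGroup innerProductSpace completeSpace

variable {A : Type u} [NonUnitalCStarAlgebra A]

/-- Irreducibility: the representation is nonzero, and its only closed invariant subspaces are
`0` and the whole space. -/
def IsIrreducible (π : StarRep.{u, v} A) : Prop :=
  π.hom ≠ 0 ∧
    ∀ K : Submodule ℂ π.space, IsClosed (K : Set π.space) →
      (∀ a : A, ∀ x ∈ K, π.hom a x ∈ K) → K = ⊥ ∨ K = ⊤

/-- The representation acts on a finite-dimensional Hilbert space. -/
def IsFiniteDimensional (π : StarRep.{u, v} A) : Prop :=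
  FiniteDimensional ℂ π.space

/-- `σ` is weakly contained in `π` if `ker π ⊆ ker σ`. -/
def WeaklyContainedIn (σ : StarRep.{u, v} A) (π : StarRep.{u, w} A) : Prop :=
  ∀ a : A, π.hom a = 0 → σ.hom a = 0

/-- Weak equivalence: each of the two representations is weakly contained in the other. -/
def WeaklyEquivalent (σ : StarRep.{u, v} A) (π : StarRep.{u, w} A) : Prop :=
  σ.WeaklyContainedIn π ∧ π.WeaklyContainedIn σ

/-- The ampliation `π⁽ⁿ⁾(T)` of `T ∈ Mₙ(A)`, as an operator on the Hilbert space direct sum of `n`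
copies of the space of `π`: it maps `x` to the vector with entries `∑ j, π (T i j) (x j)`. -/
noncomputable def ampliation (π : StarRep.{u, v} A) {n : ℕ} (T : Matrix (Fin n) (Fin n) A) :
    PiLp 2 (fun _ : Fin n => π.space) →L[ℂ] PiLp 2 (fun _ : Fin n => π.space) :=
  (PiLp.continuousLinearEquiv 2 ℂ (fun _ : Fin n => π.space)).symm.toContinuousLinearMap ∘L
    ContinuousLinearMap.pi (fun i => ∑ j, π.hom (T i j) ∘L PiLp.proj 2 (fun _ => π.space) j)

theorem ampliation_apply (π : StarRep.{u, v} A) {n : ℕ} (T : Matrix (Fin n) (Fin n) A)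
    (x : PiLp 2 (fun _ : Fin n => π.space)) (i : Fin n) :
    π.ampliation T x i = ∑ j, π.hom (T i j) (x j) := by
  simp [ampliation]

end StarRep

/-- A C*-algebra is residually finite-dimensional if it admits a separating set of
finite-dimensional `*`-representations. -/
def IsRFD (A : Type u) [NonUnitalCStarAlgebra A] : Prop :=
  ∃ S : Set (StarRep.{u, u} A), (∀ ρ ∈ S, ρ.IsFiniteDimensional) ∧
    ∀ a : A, (∀ ρ ∈ S, ρ.hom a = 0) → a = 0

/-- The irreducible `*`-representations of `A` that are not weakly equivalent to `π`. The Hilbert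
space of an irreducible representation is a quotient of `A`, so the universe of `A` contains a
representative of every unitary equivalence class. -/
def notWeaklyEquivalentIrreps {A : Type u} [NonUnitalCStarAlgebra A] (π : StarRep.{u, v} A) :
    Set (StarRep.{u, u} A) :=
  {σ | σ.IsIrreducible ∧ ¬ σ.WeaklyEquivalent π}

/-!
The ampliations of a separating family of `*`-representations of `A` separate the points of the
C*-algebra `Mₙ(A)`, so together they embed `Mₙ(A)` isometrically into the `ℓ^∞`-product of the
algebras of bounded operators they act by. Hence the norm of `T ∈ Mₙ(A)` is the supremum of the norms
`‖σ⁽ⁿ⁾(T)‖` over the family, and this supremum bounds `‖π⁽ⁿ⁾(T)‖` for every `π`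
(`StarRep.norm_ampliation_le_of_separating`).

If `A` is residually finite-dimensional, this applies to the family of finite-dimensional
*irreducible* representations: a finite-dimensional representation splits along any invariant
subspace and its orthogonal complement, so by induction on the dimension it is nonzero at `a` only if
some finite-dimensional irreducible representation is
(`StarRep.exists_isIrreducible_of_isFiniteDimensional`). A strict peak of `π` over all irreducible
representations not weakly equivalent to it thus forces some finite-dimensional irreducible `σ` to
have the same kernel as `π`. Then `π(A) ≅ A / ker π = A / ker σ ≅ σ(A)` is finite-dimensional, and so
is the space of `π`, being of the form `π(A) x` by irreducibility.
-/

/-! ### Separating families of `*`-homomorphisms -/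

/-- A separating family of `*`-homomorphisms computes the norm, because the induced map into the
`ℓ^∞`-product is an injective `*`-homomorphism and hence isometric. -/
theorem CStarAlgebra.norm_le_of_separating {ι B : Type*} {E : ι → Type*} [NonUnitalCStarAlgebra B]
    [∀ i, NonUnitalCStarAlgebra (E i)] (φ : ∀ i, B →⋆ₙₐ[ℂ] E i)
    (hφ : ∀ b : B, (∀ i, φ i b = 0) → b = 0) {b : B} {C : ℝ} (hC : 0 ≤ C)
    (h : ∀ i, ‖φ i b‖ ≤ C) : ‖b‖ ≤ C := by
  let Φ : B →⋆ₙₐ[ℂ] lp E ⊤ :=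
    { toFun := fun c => ⟨fun i => φ i c, memℓp_infty ⟨‖c‖, by
        rintro _ ⟨i, rfl⟩
        exact NonUnitalStarAlgHom.norm_apply_le (φ i) c⟩⟩
      map_smul' := fun z c => by ext i; exact map_smul (φ i) z c
      map_zero' := by ext i; exact map_zero (φ i)
      map_add' := fun c d => by ext i; exact map_add (φ i) c d
      map_mul' := fun c d => by ext i; exact map_mul (φ i) c d
      map_star' := fun c => by ext i; exact map_star (φ i) c }
  have hΦ : Function.Injective Φ := by
    rw [injective_iff_map_eq_zero]
    exact fun c hc => hφ c fun i => congrFun (congrArg Subtype.val hc) i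
  rw [← NonUnitalStarAlgHom.norm_map Φ hΦ b]
  exact lp.norm_le_of_forall_le hC h

namespace StarRep

variable {A : Type u} [NonUnitalCStarAlgebra A]

/-! ### Ampliations as `*`-homomorphisms -/

/-- The ampliation `π⁽ⁿ⁾` as a `*`-homomorphism on the C*-algebra `Mₙ(A)`. -/
noncomputable def ampliationHom (π : StarRep.{u, v} A) (n : ℕ) :
    CStarMatrix (Fin n) (Fin n) A →⋆ₙₐ[ℂ]
      (PiLp 2 (fun _ : Fin n => π.space) →L[ℂ] PiLp 2 (fun _ : Fin n => π.space)) where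
  toFun M := π.ampliation (CStarMatrix.ofMatrix.symm M)
  map_smul' c M := by
    ext x i
    simp [ampliation_apply, Finset.smul_sum]
  map_zero' := by
    ext x i
    simp [ampliation_apply]
  map_add' M N := by
    ext x i
    simp [ampliation_apply, Finset.sum_add_distrib]
  map_mul' M N := by
    ext x i
    simp only [ampliation_apply, CStarMatrix.ofMatrix_symm_apply, CStarMatrix.mul_apply, map_sum,
      map_mul, sum_apply, ContinuousLinearMap.mul_def, ContinuousLinearMap.comp_apply]
    exact Finset.sum_comm
  map_star' M := by
    rw [ContinuousLinearMap.star_eq_adjoint, ContinuousLinearMap.eq_adjoint_iff]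
    intro x y
    simp only [PiLp.inner_apply, ampliation_apply, CStarMatrix.ofMatrix_symm_apply,
      CStarMatrix.star_apply, map_star, sum_inner, inner_sum, ContinuousLinearMap.star_eq_adjoint,
      ContinuousLinearMap.adjoint_inner_left]
    exact Finset.sum_comm

theorem hom_apply_eq_zero_of_ampliation_eq_zero (π : StarRep.{u, v} A) {n : ℕ}
    {T : Matrix (Fin n) (Fin n) A} (h : π.ampliation T = 0) (i j : Fin n) :
    π.hom (T i j) = 0 := by
  ext x
  have := congrArg (fun y => y i) (DFunLike.congr_fun h (WithLp.toLp 2 (Pi.single j x)))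
  simp only [ampliation_apply] at this
  rw [Finset.sum_eq_single j (by intro b _ hb; simp [hb]) (by simp)] at this
  simpa using this

/-- The norm of `π⁽ⁿ⁾(T)` is dominated by the norms of the `σ⁽ⁿ⁾(T)` over any separating family of
representations `σ`, since the product of the `σ⁽ⁿ⁾` is an isometric representation of `Mₙ(A)`. -/
theorem norm_ampliation_le_of_separating {ι : Type*} (σ : ι → StarRep.{u, w} A)
    (hσ : ∀ a : A, (∀ i, (σ i).hom a = 0) → a = 0) (π : StarRep.{u, v} A) {n : ℕ}
    (T : Matrix (Fin n) (Fin n) A) {C : ℝ} (hC : 0 ≤ C) (h : ∀ i, ‖(σ i).ampliation T‖ ≤ C) :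
    ‖π.ampliation T‖ ≤ C := by
  -- The C*-norm on `CStarMatrix` is defined for ordered C*-algebras.
  let : PartialOrder A := CStarAlgebra.spectralOrder A
  have : StarOrderedRing A := CStarAlgebra.spectralOrderedRing A
  refine (NonUnitalStarAlgHom.norm_apply_le (π.ampliationHom n) (CStarMatrix.ofMatrix T)).trans
    (CStarAlgebra.norm_le_of_separating (fun i => (σ i).ampliationHom n) (fun M hM => ?_) hC h)
  ext i j
  exact hσ _ fun k => (σ k).hom_apply_eq_zero_of_ampliation_eq_zero (hM k) i j

/-! ### Splitting finite-dimensional representations -/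

/-- The restriction of a representation to a closed invariant subspace `K`, written as the
compression by the orthogonal projection onto `K`. -/
noncomputable def restrict (π : StarRep.{u, v} A) (K : Submodule ℂ π.space) [CompleteSpace K]
    (hK : ∀ a : A, ∀ x ∈ K, π.hom a x ∈ K) : StarRep.{u, v} A where
  space := K
  hom :=
    { toFun := fun a => K.orthogonalProjectionOnto ∘L π.hom a ∘L K.subtypeL
      map_smul' := fun c a => by ext x; simp
      map_zero' := by ext x; simp
      map_add' := fun a b => by ext x; simp
      map_mul' := fun a b => by
        ext x
        simp [Submodule.starProjection_eq_self_iff.2 (hK b x x.2)]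
      map_star' := fun a => by
        rw [ContinuousLinearMap.star_eq_adjoint, ContinuousLinearMap.eq_adjoint_iff]
        intro x y
        simp [map_star, ContinuousLinearMap.star_eq_adjoint,
          ContinuousLinearMap.adjoint_inner_left] }

theorem hom_apply_eq_zero_of_restrict (π : StarRep.{u, v} A) (K : Submodule ℂ π.space)
    [CompleteSpace K] (hK : ∀ a : A, ∀ x ∈ K, π.hom a x ∈ K) {a : A}
    (h : (π.restrict K hK).hom a = 0) {x : π.space} (hx : x ∈ K) : π.hom a x = 0 := by
  have h1 : K.orthogonalProjectionOnto (π.hom a x) = 0 := DFunLike.congr_fun h ⟨x, hx⟩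
  rw [← Submodule.starProjection_eq_self_iff.2 (hK a x hx), Submodule.starProjection_apply, h1,
    Submodule.coe_zero]

theorem hom_apply_mem_orthogonal (π : StarRep.{u, v} A) {K : Submodule ℂ π.space}
    (hK : ∀ a : A, ∀ x ∈ K, π.hom a x ∈ K) (a : A) (x : π.space) (hx : x ∈ Kᗮ) :
    π.hom a x ∈ Kᗮ := by
  rw [Submodule.mem_orthogonal] at hx ⊢
  intro y hy
  rw [← ContinuousLinearMap.adjoint_inner_left, ← ContinuousLinearMap.star_eq_adjoint, ← map_star]
  exact hx _ (hK _ y hy)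

/-- If `ρ` is finite-dimensional and `ρ(a) ≠ 0`, then one of the irreducible summands of `ρ` is
nonzero at `a`. -/
theorem exists_isIrreducible_of_isFiniteDimensional (ρ : StarRep.{u, v} A)
    (hρ : ρ.IsFiniteDimensional) {a : A} (ha : ρ.hom a ≠ 0) :
    ∃ σ : StarRep.{u, v} A, σ.IsIrreducible ∧ σ.IsFiniteDimensional ∧ σ.hom a ≠ 0 := by
  induction hd : Module.finrank ℂ ρ.space using Nat.strong_induction_on generalizing ρ with
  | _ d ih =>
  have : FiniteDimensional ℂ ρ.space := hρ
  by_cases hirr : ρ.IsIrreducible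
  · exact ⟨ρ, hirr, hρ, ha⟩
  have hne : ρ.hom ≠ 0 := fun h => ha (by rw [h]; rfl)
  simp only [IsIrreducible, not_and, not_forall, not_or] at hirr
  obtain ⟨K, -, hK, hbot, htop⟩ := hirr hne
  have hK' := ρ.hom_apply_mem_orthogonal hK
  have hsum := K.finrank_add_finrank_orthogonal
  have hlt : Module.finrank ℂ K < Module.finrank ℂ ρ.space := Submodule.finrank_lt htop
  have hpos : 0 < Module.finrank ℂ K :=
    Nat.pos_of_ne_zero fun h => hbot (Submodule.finrank_eq_zero.1 h)
  by_cases h1 : (ρ.restrict K hK).hom a = 0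
  · by_cases h2 : (ρ.restrict Kᗮ hK').hom a = 0
    · refine absurd ?_ ha
      ext x
      obtain ⟨y, hy, z, hz, rfl⟩ := K.exists_add_mem_mem_orthogonal x
      simp [ρ.hom_apply_eq_zero_of_restrict K hK h1 hy,
        ρ.hom_apply_eq_zero_of_restrict Kᗮ hK' h2 hz]
    · exact ih (Module.finrank ℂ Kᗮ) (by omega) (ρ.restrict Kᗮ hK')
        (inferInstanceAs (FiniteDimensional ℂ Kᗮ)) h2 rfl
  · exact ih (Module.finrank ℂ K) (by omega) (ρ.restrict K hK)
      (inferInstanceAs (FiniteDimensional ℂ K)) h1 rfl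

/-! ### Irreducible representations with finite-dimensional image -/

/-- The space of an irreducible representation is `π(A) x` for some vector `x`, as soon as `π(A)` is
finite-dimensional (so that `π(A) x` is closed). -/
theorem IsIrreducible.isFiniteDimensional {π : StarRep.{u, v} A} (hπ : π.IsIrreducible)
    (h : FiniteDimensional ℂ (LinearMap.range (π.hom : A →ₗ[ℂ] π.space →L[ℂ] π.space))) :
    π.IsFiniteDimensional := by
  obtain ⟨a, x, hax⟩ : ∃ a x, π.hom a x ≠ 0 := by
    by_contra! h0
    exact hπ.1 (by ext a x; exact h0 a x)
  let ev : (π.space →L[ℂ] π.space) →ₗ[ℂ] π.space :=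
    (ContinuousLinearMap.apply ℂ π.space x : (π.space →L[ℂ] π.space) →L[ℂ] π.space)
  let R := LinearMap.range (π.hom : A →ₗ[ℂ] π.space →L[ℂ] π.space)
  have : FiniteDimensional ℂ (R.map ev) := inferInstance
  have hmem (b : A) : π.hom b x ∈ R.map ev := ⟨π.hom b, ⟨b, rfl⟩, rfl⟩
  have hinv : ∀ b : A, ∀ y ∈ R.map ev, π.hom b y ∈ R.map ev := by
    rintro b _ ⟨_, ⟨c, rfl⟩, rfl⟩
    have := hmem (b * c)
    rwa [map_mul] at this
  rcases hπ.2 (R.map ev) (R.map ev).closed_of_finiteDimensional hinv with hbot | htop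
  · exact absurd ((Submodule.mem_bot ℂ).1 (hbot ▸ hmem a)) hax
  · exact Module.finite_def.2 (htop ▸ Module.Finite.iff_fg.1 ‹FiniteDimensional ℂ (R.map ev)›)

/-- If `ker σ ⊆ ker π`, then `π(A)` is a quotient of the finite-dimensional algebra `σ(A)`. -/
theorem isFiniteDimensional_of_weaklyContainedIn {σ : StarRep.{u, w} A} {π : StarRep.{u, v} A}
    (hσ : σ.IsFiniteDimensional) (hπ : π.IsIrreducible) (h : π.WeaklyContainedIn σ) :
    π.IsFiniteDimensional := by
  have : FiniteDimensional ℂ σ.space := hσ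
  apply hπ.isFiniteDimensional
  let fσ : A →ₗ[ℂ] σ.space →L[ℂ] σ.space := σ.hom
  let fπ : A →ₗ[ℂ] π.space →L[ℂ] π.space := π.hom
  have hle : LinearMap.ker fσ ≤ LinearMap.ker fπ := fun a ha => h a ha
  have : FiniteDimensional ℂ (A ⧸ LinearMap.ker fσ) :=
    Module.Finite.equiv fσ.quotKerEquivRange.symm
  have hr : LinearMap.range ((LinearMap.ker fσ).liftQ fπ hle) = LinearMap.range fπ :=
    Submodule.range_liftQ _ _ _
  change FiniteDimensional ℂ (LinearMap.range fπ)
  rw [← hr]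
  infer_instance

end StarRep

theorem IsRFD.exists_isIrreducible {A : Type u} [NonUnitalCStarAlgebra A] (hA : IsRFD A) {a : A}
    (ha : a ≠ 0) :
    ∃ σ : StarRep.{u, u} A, σ.IsIrreducible ∧ σ.IsFiniteDimensional ∧ σ.hom a ≠ 0 := by
  obtain ⟨S, hS, hsep⟩ := hA
  obtain ⟨ρ, hρ, hρa⟩ : ∃ ρ ∈ S, ρ.hom a ≠ 0 := by
    by_contra! h
    exact ha (hsep a h)
  exact ρ.exists_isIrreducible_of_isFiniteDimensional (hS ρ hρ) hρa

/-! ### Peaking representations -/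

theorem theorem3p9 {A : Type u} [NonUnitalCStarAlgebra A] (hA : IsRFD A)
    (π : StarRep.{u, v} A) (hπ : π.IsIrreducible)
    (hpeak : ∃ (n : ℕ) (T : Matrix (Fin n) (Fin n) A),
      (⨆ σ ∈ notWeaklyEquivalentIrreps π, ((‖σ.ampliation T‖ : ℝ) : EReal)) <
        ((‖π.ampliation T‖ : ℝ) : EReal)) :
    π.IsFiniteDimensional := by
  obtain ⟨n, T, hT⟩ := hpeak
  obtain ⟨C, hC, hCπ⟩ := EReal.lt_iff_exists_real_btwn.1 hT
  rw [EReal.coe_lt_coe_iff] at hCπ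
  by_contra hinf
  have hle (σ : StarRep.{u, u} A) (hσ : σ.IsIrreducible) (hfd : σ.IsFiniteDimensional) :
      ‖σ.ampliation T‖ ≤ C := by
    have hmem : σ ∈ notWeaklyEquivalentIrreps π :=
      ⟨hσ, fun he => hinf (StarRep.isFiniteDimensional_of_weaklyContainedIn hfd hπ he.2)⟩
    exact EReal.coe_le_coe_iff.1 ((le_iSup₂ (f := fun (σ : StarRep.{u, u} A)
      (_ : σ ∈ notWeaklyEquivalentIrreps π) => ((‖σ.ampliation T‖ : ℝ) : EReal)) σ hmem).trans hC.le)
  -- As `A ≠ 0`, finite-dimensional irreducible representations exist; without one, `C` could be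
  -- negative, and the bound `hle` would say nothing.
  obtain ⟨a, ha⟩ : ∃ a : A, a ≠ 0 := by
    by_contra! h
    exact hπ.1 (by ext1 a; rw [h a, map_zero, map_zero])
  obtain ⟨σ₀, hσ₀, hfd₀, -⟩ := hA.exists_isIrreducible ha
  refine hCπ.not_ge (StarRep.norm_ampliation_le_of_separating
    (fun σ : {σ : StarRep.{u, u} A // σ.IsIrreducible ∧ σ.IsFiniteDimensional} => σ.1) ?_ π T
    ((norm_nonneg _).trans (hle σ₀ hσ₀ hfd₀)) fun σ => hle σ.1 σ.2.1 σ.2.2)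
  intro b hb
  by_contra hb0
  obtain ⟨σ, hσ, hfd, hne⟩ := hA.exists_isIrreducible hb0
  exact hne (hb ⟨σ, hσ, hfd⟩)
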